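/- Let $\mathbb{R}$ be a generalized Reedy category, i.e. a small category with wide subcategories $\mathbb{R}^+,\mathbb{R}^-$ and a degree function $d:\mathrm{Ob}(\mathbb{R})\to\mathbb{N}$ such that: (i) non-invertible morphisms of $\mathbb{R}^+$ (resp. $\mathbb{R}^-$) raise (resp. lower) the degree, and isomorphisms preserve it; (ii) $\mathbb{R}^+\cap\mathbb{R}^-=\mathrm{Iso}(\mathbb{R})$; (iii) every morphism factors as $f=gh$ with $g\in\mathbb{R}^+$, $h\in\mathbb{R}^-$, uniquely up to isomorphism; (iv) if $\theta f=f$ with $\theta$ an isomorphism and $f\in\mathbb{R}^-$, then $\theta$ is an identity. Let $\mathcal{E}$ be a Quillen model category in which the colimits and limits used below exist. For $X:\mathbb{R}\to\mathcal{E}$ and $r\in\mathbb{R}$, let $L_r(X)=\varinjlim_{s\to r}X_s$, over the non-invertible morphisms $s\to r$ of $\mathbb{R}^+$, and $M_r(X)=\varprojlim_{r\to s}X_s$, over the non-invertible morphisms $r\to s$ of $\mathbb{R}^-$; the group $\mathrm{Aut}(r)$ acts on both. A map $X\to Y$ in $\mathcal{E}^{\mathbb{R}}$ is a Reedy cofibration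 if for each $r$ the map $X_r\cup_{L_r(X)}L_r(Y)\to Y_r$ is a projective cofibration in $\mathcal{E}^{\mathrm{Aut}(r)}$ (it has the left lifting property with respect to the $\mathrm{Aut}(r)$-equivariant maps that are trivial fibrations in $\mathcal{E}$), and a Reedy fibration if for each $r$ the map $X_r\to M_r(X)\times_{M_r(Y)}Y_r$ is a fibration in $\mathcal{E}$. $X$ is Reedy cofibrant (resp. fibrant) if the map from the initial object (resp. to the terminal object) of $\mathcal{E}^{\mathbb{R}}$ is a Reedy cofibration (resp. fibration). Let $t_n:\mathbb{R}_{\leq n}\hookrightarrow\mathbb{R}$ be the full subcategory of objects of degree $\leq n$, where $n\geq -1$ is an integer, and let $\mathit{sk}_n=t_{n!}t_n^*$ and $\mathit{cosk}_n=t_{n*}t_n^*$, with $t_{n!}$, $t_{n*}$ the (pointwise) left and right Kan extension along $t_n$; so $\mathit{sk}_{-1}(X)$ is initial and $\mathit{cosk}_{-1}(X)$ is terminal. Let $\mathit{sk}_\infty(X)\cong X$ (resp. $\mathit{cosk}_\infty(X)\cong X$) be the colimit of the canonical maps $\mathit{sk}_m(X)\to\mathit{sk}_n(X)$ (resp. the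 limit of the canonical maps $\mathit{cosk}_n(X)\to\mathit{cosk}_m(X)$) for $-1\leq m\leq n<\infty$. Then for any $-1\leq m<n\leq\infty$ and any object $X$ of $\mathcal{E}^{\mathbb{R}}$: (i) if $X$ is Reedy cofibrant, the canonical map $\mathit{sk}_m(X)\to\mathit{sk}_n(X)$ is a Reedy cofibration between Reedy cofibrant objects; (ii) if $X$ is Reedy fibrant, the canonical map $\mathit{cosk}_n(X)\to\mathit{cosk}_m(X)$ is a Reedy fibration between Reedy fibrant objects. -/

import Mathlib

open CategoryTheory CategoryTheory.Limits HomotopicalAlgebra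

universe v₁ u₁ v₂ u₂

/-- A generalized Reedy structure on a category `R`. -/
structure GeneralizedReedyStructure (R : Type u₁) [Category.{v₁} R] where
  /-- the morphisms of the wide subcategory `R⁺` -/
  plus : MorphismProperty R
  /-- the morphisms of the wide subcategory `R⁻` -/
  minus : MorphismProperty R
  /-- `R⁺` contains all identities and is closed under composition -/
  plus_isMultiplicative : plus.IsMultiplicative
  /-- `R⁻` contains all identities and is closed under composition -/
  minus_isMultiplicative : minus.IsMultiplicative
  /-- the degree function -/
  deg : R → ℕ
  deg_lt_of_plus : ∀ {r s : R} (f : r ⟶ s), plus f → ¬ IsIso f → deg r < deg s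
  deg_lt_of_minus : ∀ {r s : R} (f : r ⟶ s), minus f → ¬ IsIso f → deg s < deg r
  deg_eq_of_isIso : ∀ {r s : R} (f : r ⟶ s), IsIso f → deg r = deg s
  plus_and_minus_iff : ∀ {r s : R} (f : r ⟶ s), (plus f ∧ minus f) ↔ IsIso f
  /-- every morphism is a morphism of `R⁻` followed by a morphism of `R⁺` -/
  exists_factorization : ∀ {r s : R} (f : r ⟶ s),
    ∃ (t : R) (h : r ⟶ t) (g : t ⟶ s), minus h ∧ plus g ∧ h ≫ g = f
  /-- such a factorization is unique up to isomorphism -/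
  factorization_unique : ∀ {r s t t' : R} (h : r ⟶ t) (g : t ⟶ s) (h' : r ⟶ t') (g' : t' ⟶ s),
    minus h → plus g → minus h' → plus g' → h ≫ g = h' ≫ g' →
      ∃ e : t ≅ t', h ≫ e.hom = h' ∧ e.hom ≫ g' = g
  /-- automorphisms consider the morphisms of `R⁻` as epimorphisms -/
  eq_id_of_minus : ∀ {r s : R} (f : r ⟶ s) (θ : s ≅ s), minus f → f ≫ θ.hom = f →
    θ = Iso.refl s

section Projective

variable (E : Type u₂) [Category.{v₂} E] [ModelCategory E] (G : Type*) [Monoid G]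

/-- The fibrations of the projective model structure on objects with a `G`-action: the equivariant
maps whose underlying map is a fibration. -/
def projectiveFibrations : MorphismProperty (Action E G) :=
  (fibrations E).inverseImage (Action.forget E G)

/-- The weak equivalences of the projective model structure on objects with a `G`-action: the
equivariant maps whose underlying map is a weak equivalence. -/
def projectiveWeakEquivalences : MorphismProperty (Action E G) :=
  (weakEquivalences E).inverseImage (Action.forget E G)

/-- The cofibrations of the projective model structure on objects with a `G`-action: the
equivariant maps with the left lifting property against the projective trivial fibrations. -/
def projectiveCofibrations : MorphismProperty (Action E G) :=
  (projectiveFibrations E G ⊓ projectiveWeakEquivalences E G).llp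

variable {E G} in
/-- Whenever the projective model structure exists, its cofibrations are those of
`projectiveCofibrations`. -/
theorem cofibrations_eq_projectiveCofibrations (M : ModelCategory (Action E G))
    (hf : fibrations (Action E G) = projectiveFibrations E G)
    (hw : weakEquivalences (Action E G) = projectiveWeakEquivalences E G) :
    cofibrations (Action E G) = projectiveCofibrations E G := by
  have h := MorphismProperty.llp_eq_of_wfs (cofibrations (Action E G))
    (trivialFibrations (Action E G))
  rw [← h, projectiveCofibrations, trivialFibrations, hf, hw]

end Projective

namespace GeneralizedReedyStructure

variable {R : Type u₁} [Category.{v₁} R] (𝓡 : GeneralizedReedyStructure R)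
variable {E : Type u₂} [Category.{v₂} E]

section Latching

/-- The non-invertible morphisms of `R⁺` with codomain `r`. -/
def isLatching (r : R) : ObjectProperty (Over r) :=
  fun u => 𝓡.plus u.hom ∧ ¬ IsIso u.hom

/-- The category `R⁺(r)`: its objects are the non-invertible morphisms of `R⁺` with codomain `r`,
its morphisms are all the morphisms of `R` over `r`. -/
abbrev LatchingCategory (r : R) := (𝓡.isLatching r).FullSubcategory

/-- The domain functor `R⁺(r) ⥤ R`. -/
abbrev latchingDom (r : R) : 𝓡.LatchingCategory r ⥤ R :=
  (𝓡.isLatching r).ι ⋙ Over.forget r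

/-- The action of `Aut r` on the objects of `R⁺(r)` by composition. -/
def latchingAct {r : R} (θ : Aut r) (u : 𝓡.LatchingCategory r) : 𝓡.LatchingCategory r where
  obj := Over.mk (u.obj.hom ≫ θ.hom)
  property := by
    have hθ : IsIso θ.hom := Iso.isIso_hom θ
    refine ⟨?_, fun h => u.property.2 ?_⟩
    · exact 𝓡.plus_isMultiplicative.comp_mem _ _ u.property.1
        ((𝓡.plus_and_minus_iff θ.hom).2 hθ).1
    · have h' : IsIso (u.obj.hom ≫ θ.hom) := h
      exact IsIso.of_isIso_comp_right _ θ.hom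

/-- The latching object `L_r(X)`, without its action of `Aut r`. -/
noncomputable abbrev latchingObj (X : R ⥤ E) (r : R)
    [HasColimitsOfShape (𝓡.LatchingCategory r) E] : E :=
  colimit (𝓡.latchingDom r ⋙ X)

/-- The coprojection `X_s ⟶ L_r(X)` at an object `u : s ⟶ r` of `R⁺(r)`. -/
noncomputable abbrev latchingι (X : R ⥤ E) {r : R} [HasColimitsOfShape (𝓡.LatchingCategory r) E]
    (u : 𝓡.LatchingCategory r) : X.obj u.obj.left ⟶ 𝓡.latchingObj X r :=
  colimit.ι (𝓡.latchingDom r ⋙ X) u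

lemma latchingι_w (X : R ⥤ E) {r : R} [HasColimitsOfShape (𝓡.LatchingCategory r) E]
    {u u' : 𝓡.LatchingCategory r} (w : u.obj.left ⟶ u'.obj.left)
    (hw : w ≫ u'.obj.hom = u.obj.hom) :
    X.map w ≫ 𝓡.latchingι X u' = 𝓡.latchingι X u :=
  colimit.w (𝓡.latchingDom r ⋙ X) (ObjectProperty.homMk (Over.homMk w hw) : u ⟶ u')

/-- A map out of the latching object. -/
noncomputable def latchingDesc (X : R ⥤ E) {r : R} [HasColimitsOfShape (𝓡.LatchingCategory r) E]
    {A : E} (φ : ∀ u : 𝓡.LatchingCategory r, X.obj u.obj.left ⟶ A)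
    (hφ : ∀ (u u' : 𝓡.LatchingCategory r) (w : u.obj.left ⟶ u'.obj.left),
      w ≫ u'.obj.hom = u.obj.hom → X.map w ≫ φ u' = φ u) : 𝓡.latchingObj X r ⟶ A :=
  colimit.desc (𝓡.latchingDom r ⋙ X)
    { pt := A
      ι :=
        { app := φ
          naturality := fun u u' f => by
            have := hφ u u' f.hom.left (Over.w f.hom)
            simpa using this } }

@[simp]
lemma latchingι_desc (X : R ⥤ E) {r : R} [HasColimitsOfShape (𝓡.LatchingCategory r) E]
    {A : E} (φ : ∀ u : 𝓡.LatchingCategory r, X.obj u.obj.left ⟶ A) (hφ)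
    (u : 𝓡.LatchingCategory r) : 𝓡.latchingι X u ≫ 𝓡.latchingDesc X φ hφ = φ u :=
  colimit.ι_desc _ _

lemma latchingObj_hom_ext (X : R ⥤ E) {r : R} [HasColimitsOfShape (𝓡.LatchingCategory r) E]
    {A : E} {f g : 𝓡.latchingObj X r ⟶ A}
    (h : ∀ u, 𝓡.latchingι X u ≫ f = 𝓡.latchingι X u ≫ g) : f = g :=
  colimit.hom_ext h

/-- The action of an automorphism of `r` on the latching object. -/
noncomputable def latchingρ (X : R ⥤ E) {r : R} [HasColimitsOfShape (𝓡.LatchingCategory r) E]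
    (θ : Aut r) : 𝓡.latchingObj X r ⟶ 𝓡.latchingObj X r :=
  𝓡.latchingDesc X (fun u => 𝓡.latchingι X (𝓡.latchingAct θ u)) fun u u' w hw =>
    𝓡.latchingι_w X (u := 𝓡.latchingAct θ u) (u' := 𝓡.latchingAct θ u') w (by
      simp [latchingAct, reassoc_of% hw])

@[simp]
lemma latchingι_ρ (X : R ⥤ E) {r : R} [HasColimitsOfShape (𝓡.LatchingCategory r) E]
    (θ : Aut r) (u : 𝓡.LatchingCategory r) :
    𝓡.latchingι X u ≫ 𝓡.latchingρ X θ = 𝓡.latchingι X (𝓡.latchingAct θ u) :=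
  𝓡.latchingι_desc X _ _ u

/-- The latching object `L_r(X)` with its action of `Aut r`. -/
noncomputable def latching (X : R ⥤ E) (r : R)
    [HasColimitsOfShape (𝓡.LatchingCategory r) E] : Action E (Aut r) where
  V := 𝓡.latchingObj X r
  ρ :=
    { toFun := fun θ => 𝓡.latchingρ X θ
      map_one' := by
        refine 𝓡.latchingObj_hom_ext X fun u => ?_
        refine (𝓡.latchingι_ρ X 1 u).trans ?_
        refine Eq.trans ?_ (Category.comp_id _).symm
        have h := 𝓡.latchingι_w X (u := 𝓡.latchingAct 1 u) (u' := u) (𝟙 u.obj.left)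
          ((Category.id_comp _).trans (Category.comp_id _).symm)
        exact h.symm.trans ((congrArg (· ≫ _) (X.map_id _)).trans (Category.id_comp _))
      map_mul' := fun θ θ' => by
        refine 𝓡.latchingObj_hom_ext X fun u => ?_
        refine (𝓡.latchingι_ρ X (θ * θ') u).trans ?_
        have h₁ : 𝓡.latchingι X u ≫ 𝓡.latchingρ X θ' ≫ 𝓡.latchingρ X θ =
            𝓡.latchingι X (𝓡.latchingAct θ (𝓡.latchingAct θ' u)) := by
          rw [reassoc_of% (𝓡.latchingι_ρ X θ' u)]
          exact 𝓡.latchingι_ρ X θ (𝓡.latchingAct θ' u)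
        refine Eq.trans ?_ h₁.symm
        have h := 𝓡.latchingι_w X (u := 𝓡.latchingAct (θ * θ') u)
          (u' := 𝓡.latchingAct θ (𝓡.latchingAct θ' u)) (𝟙 u.obj.left)
          ((Category.id_comp _).trans (Category.assoc _ _ _))
        exact h.symm.trans ((congrArg (· ≫ _) (X.map_id _)).trans (Category.id_comp _)) }

/-- The value `X_r` with its action of `Aut r`. -/
def objAction (X : R ⥤ E) (r : R) : Action E (Aut r) where
  V := X.obj r
  ρ :=
    { toFun := fun θ => X.map θ.hom
      map_one' := X.map_id r
      map_mul' := fun θ θ' => X.map_comp θ'.hom θ.hom }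

/-- The underlying map of the latching map `L_r(X) ⟶ X_r`. -/
noncomputable def latchingMapHom (X : R ⥤ E) (r : R)
    [HasColimitsOfShape (𝓡.LatchingCategory r) E] : 𝓡.latchingObj X r ⟶ X.obj r :=
  𝓡.latchingDesc X (fun u => X.map u.obj.hom) fun _ _ _ hw =>
    (X.map_comp _ _).symm.trans (congrArg X.map hw)

@[simp]
lemma latchingι_mapHom (X : R ⥤ E) {r : R} [HasColimitsOfShape (𝓡.LatchingCategory r) E]
    (u : 𝓡.LatchingCategory r) :
    𝓡.latchingι X u ≫ 𝓡.latchingMapHom X r = X.map u.obj.hom :=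
  𝓡.latchingι_desc X _ _ u

/-- The underlying map of the map `L_r(X) ⟶ L_r(Y)` induced by `f : X ⟶ Y`. -/
noncomputable def latchingObjMap {X Y : R ⥤ E} (f : X ⟶ Y) (r : R)
    [HasColimitsOfShape (𝓡.LatchingCategory r) E] : 𝓡.latchingObj X r ⟶ 𝓡.latchingObj Y r :=
  𝓡.latchingDesc X (fun u => f.app u.obj.left ≫ 𝓡.latchingι Y u) fun u u' w hw => by
    rw [f.naturality_assoc, 𝓡.latchingι_w Y w hw]

@[simp]
lemma latchingι_objMap {X Y : R ⥤ E} (f : X ⟶ Y) {r : R}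
    [HasColimitsOfShape (𝓡.LatchingCategory r) E] (u : 𝓡.LatchingCategory r) :
    𝓡.latchingι X u ≫ 𝓡.latchingObjMap f r = f.app u.obj.left ≫ 𝓡.latchingι Y u :=
  𝓡.latchingι_desc X _ _ u

/-- The equivariant latching map `L_r(X) ⟶ X_r`. -/
noncomputable def latchingMap (X : R ⥤ E) (r : R)
    [HasColimitsOfShape (𝓡.LatchingCategory r) E] : 𝓡.latching X r ⟶ objAction X r where
  hom := 𝓡.latchingMapHom X r
  comm θ := by
    have h : 𝓡.latchingρ X θ ≫ 𝓡.latchingMapHom X r =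
        𝓡.latchingMapHom X r ≫ X.map θ.hom := by
      refine 𝓡.latchingObj_hom_ext X fun u => ?_
      rw [reassoc_of% (𝓡.latchingι_ρ X θ u), reassoc_of% (𝓡.latchingι_mapHom X u)]
      refine (𝓡.latchingι_mapHom X (𝓡.latchingAct θ u)).trans ?_
      exact X.map_comp _ _
    exact h

/-- The equivariant map `L_r(X) ⟶ L_r(Y)` induced by `f : X ⟶ Y`. -/
noncomputable def latchingFunctoriality {X Y : R ⥤ E} (f : X ⟶ Y) (r : R)
    [HasColimitsOfShape (𝓡.LatchingCategory r) E] : 𝓡.latching X r ⟶ 𝓡.latching Y r where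
  hom := 𝓡.latchingObjMap f r
  comm θ := by
    have h : 𝓡.latchingρ X θ ≫ 𝓡.latchingObjMap f r =
        𝓡.latchingObjMap f r ≫ 𝓡.latchingρ Y θ := by
      refine 𝓡.latchingObj_hom_ext X fun u => ?_
      rw [reassoc_of% (𝓡.latchingι_ρ X θ u), reassoc_of% (𝓡.latchingι_objMap f u), latchingι_ρ]
      exact 𝓡.latchingι_objMap f (𝓡.latchingAct θ u)
    exact h

/-- The equivariant map `X_r ⟶ Y_r` induced by `f : X ⟶ Y`. -/
def objActionMap {X Y : R ⥤ E} (f : X ⟶ Y) (r : R) : objAction X r ⟶ objAction Y r where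
  hom := f.app r
  comm θ := f.naturality θ.hom

lemma latching_square {X Y : R ⥤ E} (f : X ⟶ Y) (r : R)
    [HasColimitsOfShape (𝓡.LatchingCategory r) E] :
    𝓡.latchingMap X r ≫ objActionMap f r =
      𝓡.latchingFunctoriality f r ≫ 𝓡.latchingMap Y r := by
  have h : 𝓡.latchingMapHom X r ≫ f.app r = 𝓡.latchingObjMap f r ≫ 𝓡.latchingMapHom Y r := by
    refine 𝓡.latchingObj_hom_ext X fun u => ?_
    rw [reassoc_of% (𝓡.latchingι_mapHom X u), reassoc_of% (𝓡.latchingι_objMap f u),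
      latchingι_mapHom]
    exact f.naturality _
  exact Action.Hom.ext h

/-- The relative latching map `X_r ∪_{L_r(X)} L_r(Y) ⟶ Y_r`, in the category of objects of `E`
with an action of `Aut r`. -/
noncomputable def relativeLatchingMap [HasFiniteColimits E] {X Y : R ⥤ E} (f : X ⟶ Y) (r : R)
    [HasColimitsOfShape (𝓡.LatchingCategory r) E] :
    pushout (𝓡.latchingMap X r) (𝓡.latchingFunctoriality f r) ⟶ objAction Y r :=
  pushout.desc (objActionMap f r) (𝓡.latchingMap Y r) (𝓡.latching_square f r)

end Latching

section Matching

/-- The non-invertible morphisms of `R⁻` with domain `r`. -/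
def isMatching (r : R) : ObjectProperty (Under r) :=
  fun u => 𝓡.minus u.hom ∧ ¬ IsIso u.hom

/-- The category `R⁻(r)`: its objects are the non-invertible morphisms of `R⁻` with domain `r`,
its morphisms are all the morphisms of `R` under `r`. -/
abbrev MatchingCategory (r : R) := (𝓡.isMatching r).FullSubcategory

/-- The codomain functor `R⁻(r) ⥤ R`. -/
abbrev matchingCod (r : R) : 𝓡.MatchingCategory r ⥤ R :=
  (𝓡.isMatching r).ι ⋙ Under.forget r

/-- The matching object `M_r(X)`. -/
noncomputable abbrev matchingObj (X : R ⥤ E) (r : R)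
    [HasLimitsOfShape (𝓡.MatchingCategory r) E] : E :=
  limit (𝓡.matchingCod r ⋙ X)

/-- The matching map `X_r ⟶ M_r(X)`. -/
noncomputable def matchingMap (X : R ⥤ E) (r : R)
    [HasLimitsOfShape (𝓡.MatchingCategory r) E] : X.obj r ⟶ 𝓡.matchingObj X r :=
  limit.lift (𝓡.matchingCod r ⋙ X)
    { pt := X.obj r
      π :=
        { app := fun u => X.map u.obj.hom
          naturality := fun u u' f => by
            have := Under.w f.hom
            simp [← X.map_comp] } }

@[simp]
lemma matchingMap_π (X : R ⥤ E) {r : R} [HasLimitsOfShape (𝓡.MatchingCategory r) E]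
    (u : 𝓡.MatchingCategory r) :
    𝓡.matchingMap X r ≫ limit.π (𝓡.matchingCod r ⋙ X) u = X.map u.obj.hom :=
  limit.lift_π _ _

/-- The map `M_r(X) ⟶ M_r(Y)` induced by `f : X ⟶ Y`. -/
noncomputable def matchingFunctoriality {X Y : R ⥤ E} (f : X ⟶ Y) (r : R)
    [HasLimitsOfShape (𝓡.MatchingCategory r) E] : 𝓡.matchingObj X r ⟶ 𝓡.matchingObj Y r :=
  limMap (Functor.whiskerLeft (𝓡.matchingCod r) f)

@[simp]
lemma matchingFunctoriality_π {X Y : R ⥤ E} (f : X ⟶ Y) {r : R}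
    [HasLimitsOfShape (𝓡.MatchingCategory r) E] (u : 𝓡.MatchingCategory r) :
    𝓡.matchingFunctoriality f r ≫ limit.π (𝓡.matchingCod r ⋙ Y) u =
      limit.π (𝓡.matchingCod r ⋙ X) u ≫ f.app u.obj.right :=
  limMap_π _ _

lemma matching_square {X Y : R ⥤ E} (f : X ⟶ Y) (r : R)
    [HasLimitsOfShape (𝓡.MatchingCategory r) E] :
    𝓡.matchingMap X r ≫ 𝓡.matchingFunctoriality f r = f.app r ≫ 𝓡.matchingMap Y r := by
  apply limit.hom_ext
  intro u
  rw [Category.assoc, Category.assoc, matchingFunctoriality_π, matchingMap_π]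
  exact (Category.assoc _ _ _).symm.trans
    ((congrArg (· ≫ f.app u.obj.right) (𝓡.matchingMap_π X u)).trans (f.naturality _))

/-- The relative matching map `X_r ⟶ M_r(X) ×_{M_r(Y)} Y_r`. -/
noncomputable def relativeMatchingMap [HasFiniteLimits E] {X Y : R ⥤ E} (f : X ⟶ Y) (r : R)
    [HasLimitsOfShape (𝓡.MatchingCategory r) E] :
    X.obj r ⟶ pullback (𝓡.matchingFunctoriality f r) (𝓡.matchingMap Y r) :=
  pullback.lift (𝓡.matchingMap X r) (f.app r) (𝓡.matching_square f r)

end Matching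

section Reedy

variable [ModelCategory E]

/-- `f` is a Reedy cofibration if, for each `r`, the relative latching map is a projective
cofibration of objects with an action of `Aut r`. -/
def IsReedyCofibration [∀ r, HasColimitsOfShape (𝓡.LatchingCategory r) E]
    {X Y : R ⥤ E} (f : X ⟶ Y) : Prop :=
  ∀ r : R, projectiveCofibrations E (Aut r) (𝓡.relativeLatchingMap f r)

/-- `f` is a Reedy fibration if, for each `r`, the relative matching map is a fibration. (The
fibrations of objects with an action of `Aut r` are detected on underlying maps, so the action on
the relative matching map plays no role.) -/
def IsReedyFibration [∀ r, HasLimitsOfShape (𝓡.MatchingCategory r) E]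
    {X Y : R ⥤ E} (f : X ⟶ Y) : Prop :=
  ∀ r : R, fibrations E (𝓡.relativeMatchingMap f r)

/-- `X` is Reedy cofibrant if the map from the initial functor to `X` is a Reedy cofibration. -/
def IsReedyCofibrant [∀ r, HasColimitsOfShape (𝓡.LatchingCategory r) E] (X : R ⥤ E) : Prop :=
  𝓡.IsReedyCofibration (initial.to X)

/-- `X` is Reedy fibrant if the map from `X` to the terminal functor is a Reedy fibration. -/
def IsReedyFibrant [∀ r, HasLimitsOfShape (𝓡.MatchingCategory r) E] (X : R ⥤ E) : Prop :=
  𝓡.IsReedyFibration (terminal.from X)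

end Reedy

section Skeleta

/-- The objects of degree `≤ n`, for a natural number `n` or `n = ⊥`, which stands for `-1`. -/
abbrev degLE (n : WithBot ℕ) : ObjectProperty R := fun r => (𝓡.deg r : WithBot ℕ) ≤ n

lemma degLE_mono {m n : WithBot ℕ} (h : m ≤ n) : 𝓡.degLE m ≤ 𝓡.degLE n :=
  fun _ hr => le_trans hr h

/-- The full embedding `t_n : R_{≤ n} ⥤ R`. -/
abbrev trunc (n : WithBot ℕ) : (𝓡.degLE n).FullSubcategory ⥤ R := (𝓡.degLE n).ι

/-- The restriction functor `t_n^*`. -/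
abbrev restr (E : Type u₂) [Category.{v₂} E] (n : WithBot ℕ) :
    (R ⥤ E) ⥤ ((𝓡.degLE n).FullSubcategory ⥤ E) :=
  (Functor.whiskeringLeft _ _ E).obj (𝓡.trunc n)

section sk

variable [∀ (n : WithBot ℕ) (r : R), HasColimitsOfShape (CostructuredArrow (𝓡.trunc n) r) E]

/-- The `n`-skeleton functor `sk_n = t_{n!} t_n^*`. -/
noncomputable abbrev sk (n : WithBot ℕ) : (R ⥤ E) ⥤ (R ⥤ E) := 𝓡.restr E n ⋙ (𝓡.trunc n).lan

/-- The unit `t_n^* X ⟶ t_n^* sk_n X`. -/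
noncomputable def skUnit (n : WithBot ℕ) (X : R ⥤ E) :
    𝓡.trunc n ⋙ X ⟶ 𝓡.trunc n ⋙ (𝓡.sk n).obj X :=
  ((𝓡.trunc n).lanAdjunction E).unit.app (𝓡.trunc n ⋙ X)

/-- The counit `sk_n X ⟶ X`. -/
noncomputable def skCounit (n : WithBot ℕ) (X : R ⥤ E) : (𝓡.sk n).obj X ⟶ X :=
  ((𝓡.trunc n).lanAdjunction E).counit.app X

/-- The canonical map `sk_m X ⟶ sk_n X` for `m ≤ n`: the map which corresponds, under the
adjunction between `t_{m!}` and `t_m^*`, to the restriction to `R_{≤ m}` of the unit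
`t_n^* X ⟶ t_n^* sk_n X`. -/
noncomputable def skMap {m n : WithBot ℕ} (h : m ≤ n) (X : R ⥤ E) :
    (𝓡.sk m).obj X ⟶ (𝓡.sk n).obj X :=
  (((𝓡.trunc m).lanAdjunction E).homEquiv (𝓡.trunc m ⋙ X) ((𝓡.sk n).obj X)).symm
    (Functor.whiskerLeft (ObjectProperty.ιOfLE (𝓡.degLE_mono h)) (𝓡.skUnit n X))

lemma sk_hom_ext {m : WithBot ℕ} {X Y : R ⥤ E} {f g : (𝓡.sk m).obj X ⟶ Y}
    (h : 𝓡.skUnit m X ≫ Functor.whiskerLeft (𝓡.trunc m) f =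
      𝓡.skUnit m X ≫ Functor.whiskerLeft (𝓡.trunc m) g) : f = g := by
  apply (((𝓡.trunc m).lanAdjunction E).homEquiv (𝓡.trunc m ⋙ X) Y).injective
  rw [Adjunction.homEquiv_unit, Adjunction.homEquiv_unit]
  exact h

lemma skUnit_skMap {m n : WithBot ℕ} (h : m ≤ n) (X : R ⥤ E) :
    𝓡.skUnit m X ≫ Functor.whiskerLeft (𝓡.trunc m) (𝓡.skMap h X) =
      Functor.whiskerLeft (ObjectProperty.ιOfLE (𝓡.degLE_mono h)) (𝓡.skUnit n X) := by
  have := (((𝓡.trunc m).lanAdjunction E).homEquiv (𝓡.trunc m ⋙ X)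
    ((𝓡.sk n).obj X)).apply_symm_apply
      (Functor.whiskerLeft (ObjectProperty.ιOfLE (𝓡.degLE_mono h)) (𝓡.skUnit n X))
  rw [Adjunction.homEquiv_unit] at this
  exact this

lemma skUnit_skCounit (n : WithBot ℕ) (X : R ⥤ E) :
    𝓡.skUnit n X ≫ Functor.whiskerLeft (𝓡.trunc n) (𝓡.skCounit n X) = 𝟙 (𝓡.trunc n ⋙ X) :=
  ((𝓡.trunc n).lanAdjunction E).right_triangle_components X

lemma skMap_refl (n : WithBot ℕ) (X : R ⥤ E) : 𝓡.skMap (le_refl n) X = 𝟙 _ := by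
  apply 𝓡.sk_hom_ext
  rw [skUnit_skMap]
  exact (Category.comp_id _).symm

lemma skMap_trans {l m n : WithBot ℕ} (h : l ≤ m) (h' : m ≤ n) (X : R ⥤ E) :
    𝓡.skMap h X ≫ 𝓡.skMap h' X = 𝓡.skMap (h.trans h') X := by
  apply 𝓡.sk_hom_ext
  have h₁ := 𝓡.skUnit_skMap h X
  have h₂ := congrArg (Functor.whiskerLeft (ObjectProperty.ιOfLE (𝓡.degLE_mono h)))
    (𝓡.skUnit_skMap h' X)
  rw [skUnit_skMap, Functor.whiskerLeft_comp, reassoc_of% h₁]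
  exact h₂

lemma skMap_skCounit {m n : WithBot ℕ} (h : m ≤ n) (X : R ⥤ E) :
    𝓡.skMap h X ≫ 𝓡.skCounit n X = 𝓡.skCounit m X := by
  apply 𝓡.sk_hom_ext
  have h₁ := 𝓡.skUnit_skMap h X
  have h₂ := congrArg (Functor.whiskerLeft (ObjectProperty.ιOfLE (𝓡.degLE_mono h)))
    (𝓡.skUnit_skCounit n X)
  rw [skUnit_skCounit, Functor.whiskerLeft_comp, reassoc_of% h₁]
  exact h₂

/-- The skeletal system `sk_{-1} X ⟶ sk_0 X ⟶ sk_1 X ⟶ ⋯`. -/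
noncomputable def skSystem (X : R ⥤ E) : WithBot ℕ ⥤ (R ⥤ E) where
  obj n := (𝓡.sk n).obj X
  map f := 𝓡.skMap (leOfHom f) X
  map_id n := 𝓡.skMap_refl n X
  map_comp f g := (𝓡.skMap_trans (leOfHom f) (leOfHom g) X).symm

/-- The cocone on the skeletal system given by the counits `sk_n X ⟶ X`. -/
noncomputable def skCocone (X : R ⥤ E) : Cocone (𝓡.skSystem X) where
  pt := X
  ι :=
    { app := fun n => 𝓡.skCounit n X
      naturality := fun _ _ f =>
        (𝓡.skMap_skCounit (leOfHom f) X).trans (Category.comp_id _).symm }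

lemma isIso_skCounit_app (X : R ⥤ E) {n : WithBot ℕ} {r : R} (h : 𝓡.degLE n r) :
    IsIso ((𝓡.skCounit n X).app r) := by
  have h₁ := congr_app (𝓡.skUnit_skCounit n X) ⟨r, h⟩
  have h₂ : IsIso ((𝓡.skUnit n X).app ⟨r, h⟩) := by
    unfold skUnit
    rw [Functor.lanAdjunction_unit]
    infer_instance
  have h₃ : (𝓡.skUnit n X).app ⟨r, h⟩ ≫ (𝓡.skCounit n X).app r = 𝟙 (X.obj r) := h₁
  have h₄ : (𝓡.skCounit n X).app r = inv ((𝓡.skUnit n X).app ⟨r, h⟩) :=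
    IsIso.eq_inv_of_hom_inv_id h₃
  rw [h₄]
  infer_instance

/-- The colimit `sk_∞ X` of the skeletal system is `X`. -/
theorem nonempty_isColimit_skCocone (X : R ⥤ E) : Nonempty (IsColimit (𝓡.skCocone X)) := by
  refine ⟨evaluationJointlyReflectsColimits _ fun r => ?_⟩
  have hi : ∀ n : WithBot ℕ, (𝓡.deg r : WithBot ℕ) ≤ n → IsIso ((𝓡.skCounit n X).app r) :=
    fun n h => 𝓡.isIso_skCounit_app X h
  have hF : (𝓡.skSystem X ⋙ (evaluation R E).obj r).IsEventuallyConstantFrom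
      (𝓡.deg r : WithBot ℕ) := fun n f => by
    have h₁ := hi _ le_rfl
    have h₂ := hi n (leOfHom f)
    have h₃ : IsIso ((𝓡.skMap (leOfHom f) X).app r) :=
      IsIso.of_isIso_fac_right (congr_app (𝓡.skMap_skCounit (leOfHom f) X) r)
    exact h₃
  have hd : IsIso ((((evaluation R E).obj r).mapCocone (𝓡.skCocone X)).ι.app
      (𝓡.deg r : WithBot ℕ)) := hi _ le_rfl
  exact hF.isColimitOfIsIso _

/-- `sk_{-1} X` is an initial object. -/
theorem nonempty_isInitial_sk_bot (X : R ⥤ E) :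
    Nonempty (IsInitial ((𝓡.sk (⊥ : WithBot ℕ)).obj X)) := by
  have hE : ∀ a : (𝓡.degLE (⊥ : WithBot ℕ)).FullSubcategory, False := fun a =>
    WithBot.not_coe_le_bot _ a.property
  refine ⟨IsInitial.ofUniqueHom (fun Y =>
    (((𝓡.trunc ⊥).lanAdjunction E).homEquiv (𝓡.trunc ⊥ ⋙ X) Y).symm
      { app := fun a => (hE a).elim
        naturality := fun a => (hE a).elim }) fun Y f => 𝓡.sk_hom_ext ?_⟩
  ext a
  exact (hE a).elim

end sk

section cosk

variable [∀ (n : WithBot ℕ) (r : R), HasLimitsOfShape (StructuredArrow r (𝓡.trunc n)) E]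

/-- The `n`-coskeleton functor `cosk_n = t_{n*} t_n^*`. -/
noncomputable abbrev cosk (n : WithBot ℕ) : (R ⥤ E) ⥤ (R ⥤ E) :=
  𝓡.restr E n ⋙ (𝓡.trunc n).ran

/-- The counit `t_n^* cosk_n X ⟶ t_n^* X`. -/
noncomputable def coskCounit (n : WithBot ℕ) (X : R ⥤ E) :
    𝓡.trunc n ⋙ (𝓡.cosk n).obj X ⟶ 𝓡.trunc n ⋙ X :=
  ((𝓡.trunc n).ranAdjunction E).counit.app (𝓡.trunc n ⋙ X)

/-- The unit `X ⟶ cosk_n X`. -/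
noncomputable def coskUnit (n : WithBot ℕ) (X : R ⥤ E) : X ⟶ (𝓡.cosk n).obj X :=
  ((𝓡.trunc n).ranAdjunction E).unit.app X

/-- The canonical map `cosk_n X ⟶ cosk_m X` for `m ≤ n`: the map which corresponds, under the
adjunction between `t_m^*` and `t_{m*}`, to the restriction to `R_{≤ m}` of the counit
`t_n^* cosk_n X ⟶ t_n^* X`. -/
noncomputable def coskMap {m n : WithBot ℕ} (h : m ≤ n) (X : R ⥤ E) :
    (𝓡.cosk n).obj X ⟶ (𝓡.cosk m).obj X :=
  ((𝓡.trunc m).ranAdjunction E).homEquiv ((𝓡.cosk n).obj X) (𝓡.trunc m ⋙ X)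
    (Functor.whiskerLeft (ObjectProperty.ιOfLE (𝓡.degLE_mono h)) (𝓡.coskCounit n X))

lemma cosk_hom_ext {m : WithBot ℕ} {X Y : R ⥤ E} {f g : Y ⟶ (𝓡.cosk m).obj X}
    (h : Functor.whiskerLeft (𝓡.trunc m) f ≫ 𝓡.coskCounit m X =
      Functor.whiskerLeft (𝓡.trunc m) g ≫ 𝓡.coskCounit m X) : f = g := by
  apply (((𝓡.trunc m).ranAdjunction E).homEquiv Y (𝓡.trunc m ⋙ X)).symm.injective
  rw [Adjunction.homEquiv_counit, Adjunction.homEquiv_counit]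
  exact h

lemma coskMap_coskCounit {m n : WithBot ℕ} (h : m ≤ n) (X : R ⥤ E) :
    Functor.whiskerLeft (𝓡.trunc m) (𝓡.coskMap h X) ≫ 𝓡.coskCounit m X =
      Functor.whiskerLeft (ObjectProperty.ιOfLE (𝓡.degLE_mono h)) (𝓡.coskCounit n X) := by
  have := (((𝓡.trunc m).ranAdjunction E).homEquiv ((𝓡.cosk n).obj X)
    (𝓡.trunc m ⋙ X)).symm_apply_apply
      (Functor.whiskerLeft (ObjectProperty.ιOfLE (𝓡.degLE_mono h)) (𝓡.coskCounit n X))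
  rw [Adjunction.homEquiv_counit] at this
  exact this

lemma coskUnit_coskCounit (n : WithBot ℕ) (X : R ⥤ E) :
    Functor.whiskerLeft (𝓡.trunc n) (𝓡.coskUnit n X) ≫ 𝓡.coskCounit n X = 𝟙 (𝓡.trunc n ⋙ X) :=
  ((𝓡.trunc n).ranAdjunction E).left_triangle_components X

lemma coskMap_refl (n : WithBot ℕ) (X : R ⥤ E) : 𝓡.coskMap (le_refl n) X = 𝟙 _ := by
  apply 𝓡.cosk_hom_ext
  rw [coskMap_coskCounit]
  exact (Category.id_comp _).symm

lemma coskMap_trans {l m n : WithBot ℕ} (h : l ≤ m) (h' : m ≤ n) (X : R ⥤ E) :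
    𝓡.coskMap h' X ≫ 𝓡.coskMap h X = 𝓡.coskMap (h.trans h') X := by
  apply 𝓡.cosk_hom_ext
  have h₁ := 𝓡.coskMap_coskCounit h X
  have h₂ := congrArg (Functor.whiskerLeft (ObjectProperty.ιOfLE (𝓡.degLE_mono h)))
    (𝓡.coskMap_coskCounit h' X)
  rw [coskMap_coskCounit, Functor.whiskerLeft_comp, Category.assoc, h₁]
  exact h₂

lemma coskUnit_coskMap {m n : WithBot ℕ} (h : m ≤ n) (X : R ⥤ E) :
    𝓡.coskUnit n X ≫ 𝓡.coskMap h X = 𝓡.coskUnit m X := by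
  apply 𝓡.cosk_hom_ext
  have h₁ := 𝓡.coskMap_coskCounit h X
  have h₂ := congrArg (Functor.whiskerLeft (ObjectProperty.ιOfLE (𝓡.degLE_mono h)))
    (𝓡.coskUnit_coskCounit n X)
  rw [coskUnit_coskCounit, Functor.whiskerLeft_comp, Category.assoc, h₁]
  exact h₂

/-- The coskeletal system `⋯ ⟶ cosk_1 X ⟶ cosk_0 X ⟶ cosk_{-1} X`. -/
noncomputable def coskSystem (X : R ⥤ E) : (WithBot ℕ)ᵒᵖ ⥤ (R ⥤ E) where
  obj n := (𝓡.cosk n.unop).obj X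
  map f := 𝓡.coskMap (leOfHom f.unop) X
  map_id n := 𝓡.coskMap_refl n.unop X
  map_comp f g := (𝓡.coskMap_trans (leOfHom g.unop) (leOfHom f.unop) X).symm

/-- The cone on the coskeletal system given by the units `X ⟶ cosk_n X`. -/
noncomputable def coskCone (X : R ⥤ E) : Cone (𝓡.coskSystem X) where
  pt := X
  π :=
    { app := fun n => 𝓡.coskUnit n.unop X
      naturality := fun _ _ f =>
        (Category.id_comp _).trans (𝓡.coskUnit_coskMap (leOfHom f.unop) X).symm }

lemma isIso_coskUnit_app (X : R ⥤ E) {n : WithBot ℕ} {r : R} (h : 𝓡.degLE n r) :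
    IsIso ((𝓡.coskUnit n X).app r) := by
  have h₁ := congr_app (𝓡.coskUnit_coskCounit n X) ⟨r, h⟩
  have h₂ : IsIso ((𝓡.coskCounit n X).app ⟨r, h⟩) := by
    unfold coskCounit
    rw [Functor.ranAdjunction_counit]
    infer_instance
  have h₃ : (𝓡.coskUnit n X).app r ≫ (𝓡.coskCounit n X).app ⟨r, h⟩ = 𝟙 (X.obj r) := h₁
  have h₄ : (𝓡.coskUnit n X).app r = inv ((𝓡.coskCounit n X).app ⟨r, h⟩) :=
    IsIso.eq_inv_of_inv_hom_id h₃
  rw [h₄]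
  infer_instance

/-- The limit `cosk_∞ X` of the coskeletal system is `X`. -/
theorem nonempty_isLimit_coskCone (X : R ⥤ E) : Nonempty (IsLimit (𝓡.coskCone X)) := by
  refine ⟨evaluationJointlyReflectsLimits _ fun r => ?_⟩
  have hi : ∀ n : WithBot ℕ, (𝓡.deg r : WithBot ℕ) ≤ n → IsIso ((𝓡.coskUnit n X).app r) :=
    fun n h => 𝓡.isIso_coskUnit_app X h
  have hF : (𝓡.coskSystem X ⋙ (evaluation R E).obj r).IsEventuallyConstantTo
      (Opposite.op (𝓡.deg r : WithBot ℕ)) := fun n f => by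
    have h₁ := hi _ le_rfl
    have h₂ := hi n.unop (leOfHom f.unop)
    have h₃ : IsIso ((𝓡.coskMap (leOfHom f.unop) X).app r) :=
      IsIso.of_isIso_fac_left (congr_app (𝓡.coskUnit_coskMap (leOfHom f.unop) X) r)
    exact h₃
  have hd : IsIso ((((evaluation R E).obj r).mapCone (𝓡.coskCone X)).π.app
      (Opposite.op (𝓡.deg r : WithBot ℕ))) := hi _ le_rfl
  exact hF.isLimitOfIsIso _

/-- `cosk_{-1} X` is a terminal object. -/
theorem nonempty_isTerminal_cosk_bot (X : R ⥤ E) :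
    Nonempty (IsTerminal ((𝓡.cosk (⊥ : WithBot ℕ)).obj X)) := by
  have hE : ∀ a : (𝓡.degLE (⊥ : WithBot ℕ)).FullSubcategory, False := fun a =>
    WithBot.not_coe_le_bot _ a.property
  refine ⟨IsTerminal.ofUniqueHom (fun Y =>
    ((𝓡.trunc ⊥).ranAdjunction E).homEquiv Y (𝓡.trunc ⊥ ⋙ X)
      { app := fun a => (hE a).elim
        naturality := fun a => (hE a).elim }) fun Y f => 𝓡.cosk_hom_ext ?_⟩
  ext a
  exact (hE a).elim

end cosk

end Skeleta

end GeneralizedReedyStructure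

namespace GeneralizedReedyStructure

/-! ### Degrees and Reedy factorizations -/

variable {R : Type u₁} [Category.{v₁} R] (𝓡 : GeneralizedReedyStructure R)
variable {E : Type u₂} [Category.{v₂} E]

/-! Two facts about skeleta carry part (i). Since `t_n` is fully faithful, the counit `sk_n X ⟶ X`
is invertible in degrees `≤ n`. Above degree `n` the latching maps of `sk_n X` are invertible
(`isIso_latchingMap_of_isPointwiseLeftKanExtension`): if `deg t ≤ n < deg r`, every `t ⟶ r` factors
as a morphism of `R⁻` followed by a non-invertible morphism of `R⁺`, and by uniqueness of
factorizations the map from `X_t` to the latching object at `r` does not depend on the choice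
(`map_latchingι_eq`). So the colimit that computes the Kan extension at `r` maps back to the
latching object.

Reedy cofibrancy says that the latching maps are projective cofibrations. Those of `sk_n X` are
either isomorphic to those of `X` or invertible, so cofibrancy passes from `X` to `sk_n X`. The
relative latching map of `sk_m X ⟶ sk_n X` at `r` is invertible if `deg r ≤ m`; if `deg r > m` it
is, up to isomorphism, the latching map of `sk_n X`. The argument applies to `n = ∞` with `X` in
place of `sk_n X`, and `isReedyCofibration_of_skCounit_fac` treats both cases at once. Part (ii) is
the dual argument with matching objects. -/

lemma deg_le_of_plus {r s : R} (f : r ⟶ s) (hf : 𝓡.plus f) : 𝓡.deg r ≤ 𝓡.deg s := by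
  by_cases h : IsIso f
  · exact (𝓡.deg_eq_of_isIso f h).le
  · exact (𝓡.deg_lt_of_plus f hf h).le

lemma deg_le_of_minus {r s : R} (f : r ⟶ s) (hf : 𝓡.minus f) : 𝓡.deg s ≤ 𝓡.deg r := by
  by_cases h : IsIso f
  · exact (𝓡.deg_eq_of_isIso f h).ge
  · exact (𝓡.deg_lt_of_minus f hf h).le

lemma latching_deg_lt {r : R} (u : 𝓡.LatchingCategory r) : 𝓡.deg u.obj.left < 𝓡.deg r :=
  𝓡.deg_lt_of_plus _ u.property.1 u.property.2

lemma matching_deg_lt {r : R} (u : 𝓡.MatchingCategory r) : 𝓡.deg u.obj.right < 𝓡.deg r :=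
  𝓡.deg_lt_of_minus _ u.property.1 u.property.2

/-- The object of `R⁺(r)` given by a morphism of `R⁺` which raises the degree. -/
def latchingMk {s r : R} (g : s ⟶ r) (hg : 𝓡.plus g) (h : 𝓡.deg s < 𝓡.deg r) :
    𝓡.LatchingCategory r where
  obj := Over.mk g
  property := ⟨hg, fun hi => h.ne (𝓡.deg_eq_of_isIso g hi)⟩

/-- The object of `R⁻(r)` given by a morphism of `R⁻` which lowers the degree. -/
def matchingMk {s r : R} (h : r ⟶ s) (hh : 𝓡.minus h) (hd : 𝓡.deg s < 𝓡.deg r) :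
    𝓡.MatchingCategory r where
  obj := Under.mk h
  property := ⟨hh, fun hi => hd.ne (𝓡.deg_eq_of_isIso h hi).symm⟩

/-- A morphism which starts in degree below that of its codomain `r` factors through an object of
`R⁺(r)`. -/
lemma exists_latching_factorization {t r : R} (f : t ⟶ r) (h : 𝓡.deg t < 𝓡.deg r) :
    ∃ (u : 𝓡.LatchingCategory r) (a : t ⟶ u.obj.left), a ≫ u.obj.hom = f := by
  -- The `R⁻` factor does not raise the degree, so the middle object still lies below `r` and the
  -- `R⁺` factor cannot be invertible.
  obtain ⟨s, a, g, ha, hg, w⟩ := 𝓡.exists_factorization f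
  exact ⟨𝓡.latchingMk g hg ((𝓡.deg_le_of_minus a ha).trans_lt h), a, w⟩

/-- A morphism which ends in degree below that of its domain `r` factors through an object of
`R⁻(r)`. -/
lemma exists_matching_factorization {t r : R} (f : r ⟶ t) (h : 𝓡.deg t < 𝓡.deg r) :
    ∃ (u : 𝓡.MatchingCategory r) (a : u.obj.right ⟶ t), u.obj.hom ≫ a = f := by
  obtain ⟨s, g, a, hg, ha, w⟩ := 𝓡.exists_factorization f
  exact ⟨𝓡.matchingMk g hg ((𝓡.deg_le_of_plus a ha).trans_lt h), a, w⟩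

/-! ### Latching objects: independence of factorizations and invariance -/

section Latching

/-- The map `X_t ⟶ X_s ⟶ L_r(X)` depends only on the composite `t ⟶ s ⟶ r`. -/
lemma map_latchingι_eq (X : R ⥤ E) {r t : R} [HasColimitsOfShape (𝓡.LatchingCategory r) E]
    (u u' : 𝓡.LatchingCategory r) (a : t ⟶ u.obj.left) (a' : t ⟶ u'.obj.left)
    (w : a ≫ u.obj.hom = a' ≫ u'.obj.hom) :
    X.map a ≫ 𝓡.latchingι X u = X.map a' ≫ 𝓡.latchingι X u' := by
  have := 𝓡.plus_isMultiplicative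
  -- Absorbing the `R⁺` parts of `a` and `a'` into `u` and `u'` gives two Reedy factorizations of
  -- the same morphism `t ⟶ r`. The isomorphism `e` between them, together with `g` and `g'`,
  -- consists of morphisms over `r`, so the cocone relations of the latching object link the two
  -- sides.
  obtain ⟨s, h, g, hh, hg, rfl⟩ := 𝓡.exists_factorization a
  obtain ⟨s', h', g', hh', hg', rfl⟩ := 𝓡.exists_factorization a'
  have hp : 𝓡.plus (g ≫ u.obj.hom) := 𝓡.plus.comp_mem _ _ hg u.property.1
  have hp' : 𝓡.plus (g' ≫ u'.obj.hom) := 𝓡.plus.comp_mem _ _ hg' u'.property.1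
  obtain ⟨e, he, he'⟩ := 𝓡.factorization_unique h (g ≫ u.obj.hom) h' (g' ≫ u'.obj.hom)
    hh hp hh' hp' (by simpa using w)
  let v := 𝓡.latchingMk _ hp ((𝓡.deg_le_of_plus g hg).trans_lt (𝓡.latching_deg_lt u))
  let v' := 𝓡.latchingMk _ hp' ((𝓡.deg_le_of_plus g' hg').trans_lt (𝓡.latching_deg_lt u'))
  have h₁ := 𝓡.latchingι_w X (u := v) (u' := u) g rfl
  have h₂ := 𝓡.latchingι_w X (u := v') (u' := u') g' rfl
  have h₃ := 𝓡.latchingι_w X (u := v) (u' := v') e.hom he'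
  calc
    _ = X.map h ≫ X.map g ≫ 𝓡.latchingι X u := by rw [X.map_comp, Category.assoc]
    _ = X.map h ≫ 𝓡.latchingι X v := congrArg (X.map h ≫ ·) h₁
    _ = X.map h ≫ X.map e.hom ≫ 𝓡.latchingι X v' := (congrArg (X.map h ≫ ·) h₃).symm
    _ = X.map h' ≫ 𝓡.latchingι X v' := by
      rw [← he, X.map_comp]; exact (Category.assoc _ _ _).symm
    _ = X.map h' ≫ X.map g' ≫ 𝓡.latchingι X u' := (congrArg (X.map h' ≫ ·) h₂).symm
    _ = _ := by rw [X.map_comp, Category.assoc]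

/-- The latching object at `r` is built from values in degrees below that of `r`. The bound is `≤`
so that one assumption also covers the value at `r` when latching maps are compared. -/
lemma isIso_latchingObjMap {X Y : R ⥤ E} (f : X ⟶ Y) (r : R)
    [HasColimitsOfShape (𝓡.LatchingCategory r) E]
    (hf : ∀ s, 𝓡.deg s ≤ 𝓡.deg r → IsIso (f.app s)) : IsIso (𝓡.latchingObjMap f r) := by
  have hf' (u : 𝓡.LatchingCategory r) : IsIso (f.app u.obj.left) :=
    hf _ (𝓡.latching_deg_lt u).le
  refine ⟨𝓡.latchingDesc Y (fun u => inv (f.app u.obj.left) ≫ 𝓡.latchingι X u) ?_, ?_, ?_⟩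
  · intro u u' w hw
    rw [IsIso.eq_inv_comp, ← f.naturality_assoc, IsIso.hom_inv_id_assoc, 𝓡.latchingι_w X w hw]
  · refine 𝓡.latchingObj_hom_ext X fun u => ?_
    rw [reassoc_of% (𝓡.latchingι_objMap f u), latchingι_desc, IsIso.hom_inv_id_assoc]
    exact (Category.comp_id _).symm
  · refine 𝓡.latchingObj_hom_ext Y fun u => ?_
    have h := congrArg (· ≫ 𝓡.latchingObjMap f r) (𝓡.latchingι_desc Y
      (fun u => inv (f.app u.obj.left) ≫ 𝓡.latchingι X u) (by
        intro u u' w hw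
        rw [IsIso.eq_inv_comp, ← f.naturality_assoc, IsIso.hom_inv_id_assoc,
          𝓡.latchingι_w X w hw]) u)
    refine (Category.assoc _ _ _).symm.trans (h.trans ?_)
    refine (Category.assoc _ _ _).trans ?_
    rw [latchingι_objMap, IsIso.inv_hom_id_assoc]
    exact (Category.comp_id _).symm

lemma isIso_latchingFunctoriality {X Y : R ⥤ E} (f : X ⟶ Y) (r : R)
    [HasColimitsOfShape (𝓡.LatchingCategory r) E]
    (hf : ∀ s, 𝓡.deg s ≤ 𝓡.deg r → IsIso (f.app s)) :
    IsIso (𝓡.latchingFunctoriality f r) := by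
  have : IsIso (𝓡.latchingFunctoriality f r).hom := 𝓡.isIso_latchingObjMap f r hf
  exact Action.isIso_of_hom_isIso _

lemma isIso_objActionMap {X Y : R ⥤ E} (f : X ⟶ Y) (r : R) [IsIso (f.app r)] :
    IsIso (objActionMap f r) := by
  have : IsIso (objActionMap f r).hom := inferInstanceAs (IsIso (f.app r))
  exact Action.isIso_of_hom_isIso _

/-- Both ends are initial in `E`. This reduces Reedy cofibrancy to a condition on the absolute
latching maps. -/
lemma isIso_latchingMap_initial [HasInitial E] (r : R)
    [HasColimitsOfShape (𝓡.LatchingCategory r) E] :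
    IsIso (𝓡.latchingMap (⊥_ (R ⥤ E)) r) := by
  have hI (s : R) : IsInitial ((⊥_ (R ⥤ E)).obj s) :=
    IsInitial.isInitialObj ((evaluation R E).obj s) _ initialIsInitial
  have hL : IsInitial (𝓡.latchingObj (⊥_ (R ⥤ E)) r) :=
    IsInitial.ofUniqueHom
      (fun A => 𝓡.latchingDesc _ (fun u => (hI u.obj.left).to A) fun u u' w hw =>
        (hI u.obj.left).hom_ext _ _)
      fun A g => 𝓡.latchingObj_hom_ext _ fun u => (hI u.obj.left).hom_ext _ _
  have : IsIso (𝓡.latchingMap (⊥_ (R ⥤ E)) r).hom :=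
    (hL.hom_ext (hL.uniqueUpToIso (hI r)).hom (𝓡.latchingMap (⊥_ (R ⥤ E)) r).hom) ▸
      (hL.uniqueUpToIso (hI r)).isIso_hom
  exact Action.isIso_of_hom_isIso _

end Latching

/-! ### Matching objects: the dual statements -/

section Matching

/-- The projection `M_r(X) ⟶ X_s` at an object `u : r ⟶ s` of `R⁻(r)`. -/
noncomputable def matchingπ (X : R ⥤ E) {r : R} [HasLimitsOfShape (𝓡.MatchingCategory r) E]
    (u : 𝓡.MatchingCategory r) : 𝓡.matchingObj X r ⟶ X.obj u.obj.right :=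
  limit.π (𝓡.matchingCod r ⋙ X) u

lemma matchingπ_w (X : R ⥤ E) {r : R} [HasLimitsOfShape (𝓡.MatchingCategory r) E]
    {u u' : 𝓡.MatchingCategory r} (w : u.obj.right ⟶ u'.obj.right)
    (hw : u.obj.hom ≫ w = u'.obj.hom) :
    𝓡.matchingπ X u ≫ X.map w = 𝓡.matchingπ X u' :=
  limit.w (𝓡.matchingCod r ⋙ X) (ObjectProperty.homMk (Under.homMk w hw) : u ⟶ u')

lemma matchingObj_hom_ext (X : R ⥤ E) {r : R} [HasLimitsOfShape (𝓡.MatchingCategory r) E]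
    {A : E} {f g : A ⟶ 𝓡.matchingObj X r}
    (h : ∀ u, f ≫ 𝓡.matchingπ X u = g ≫ 𝓡.matchingπ X u) : f = g :=
  limit.hom_ext h

lemma matchingMap_matchingπ (X : R ⥤ E) {r : R} [HasLimitsOfShape (𝓡.MatchingCategory r) E]
    (u : 𝓡.MatchingCategory r) : 𝓡.matchingMap X r ≫ 𝓡.matchingπ X u = X.map u.obj.hom :=
  𝓡.matchingMap_π X u

/-- The map `M_r(X) ⟶ X_s ⟶ X_t` depends only on the composite `r ⟶ s ⟶ t`. -/
lemma matchingπ_map_eq (X : R ⥤ E) {r t : R} [HasLimitsOfShape (𝓡.MatchingCategory r) E]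
    (u u' : 𝓡.MatchingCategory r) (a : u.obj.right ⟶ t) (a' : u'.obj.right ⟶ t)
    (w : u.obj.hom ≫ a = u'.obj.hom ≫ a') :
    𝓡.matchingπ X u ≫ X.map a = 𝓡.matchingπ X u' ≫ X.map a' := by
  have := 𝓡.minus_isMultiplicative
  -- Here the `R⁻` parts are absorbed into `u` and `u'`, and the two resulting factorizations of `r
  -- ⟶ t` are compared.
  obtain ⟨s, h, g, hh, hg, rfl⟩ := 𝓡.exists_factorization a
  obtain ⟨s', h', g', hh', hg', rfl⟩ := 𝓡.exists_factorization a'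
  have hp : 𝓡.minus (u.obj.hom ≫ h) := 𝓡.minus.comp_mem _ _ u.property.1 hh
  have hp' : 𝓡.minus (u'.obj.hom ≫ h') := 𝓡.minus.comp_mem _ _ u'.property.1 hh'
  obtain ⟨e, he, he'⟩ := 𝓡.factorization_unique (u.obj.hom ≫ h) g (u'.obj.hom ≫ h') g'
    hp hg hp' hg' (by simpa using w)
  let v := 𝓡.matchingMk _ hp ((𝓡.deg_le_of_minus h hh).trans_lt (𝓡.matching_deg_lt u))
  let v' := 𝓡.matchingMk _ hp' ((𝓡.deg_le_of_minus h' hh').trans_lt (𝓡.matching_deg_lt u'))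
  have h₁ := 𝓡.matchingπ_w X (u := u) (u' := v) h rfl
  have h₂ := 𝓡.matchingπ_w X (u := u') (u' := v') h' rfl
  have h₃ := 𝓡.matchingπ_w X (u := v) (u' := v') e.hom he
  calc
    _ = (𝓡.matchingπ X u ≫ X.map h) ≫ X.map g := by rw [X.map_comp, Category.assoc]
    _ = 𝓡.matchingπ X v ≫ X.map g := congrArg (· ≫ X.map g) h₁
    _ = (𝓡.matchingπ X v ≫ X.map e.hom) ≫ X.map g' := by
      rw [← he']
      exact (congrArg (𝓡.matchingπ X v ≫ ·) (X.map_comp e.hom g')).trans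
        (Category.assoc _ _ _).symm
    _ = 𝓡.matchingπ X v' ≫ X.map g' := congrArg (· ≫ X.map g') h₃
    _ = (𝓡.matchingπ X u' ≫ X.map h') ≫ X.map g' := (congrArg (· ≫ X.map g') h₂).symm
    _ = _ := by rw [X.map_comp, Category.assoc]

lemma isIso_matchingFunctoriality {X Y : R ⥤ E} (f : X ⟶ Y) (r : R)
    [HasLimitsOfShape (𝓡.MatchingCategory r) E]
    (hf : ∀ s, 𝓡.deg s ≤ 𝓡.deg r → IsIso (f.app s)) :
    IsIso (𝓡.matchingFunctoriality f r) := by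
  have hf' (u : 𝓡.MatchingCategory r) :
      IsIso ((Functor.whiskerLeft (𝓡.matchingCod r) f).app u) :=
    hf _ (𝓡.matching_deg_lt u).le
  have := NatIso.isIso_of_isIso_app (Functor.whiskerLeft (𝓡.matchingCod r) f)
  unfold matchingFunctoriality
  infer_instance

lemma isIso_matchingMap_terminal [HasTerminal E] (r : R)
    [HasLimitsOfShape (𝓡.MatchingCategory r) E] :
    IsIso (𝓡.matchingMap (⊤_ (R ⥤ E)) r) := by
  have hT (s : R) : IsTerminal ((⊤_ (R ⥤ E)).obj s) :=
    IsTerminal.isTerminalObj ((evaluation R E).obj s) _ terminalIsTerminal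
  have hM : IsTerminal (𝓡.matchingObj (⊤_ (R ⥤ E)) r) :=
    IsTerminal.ofUniqueHom
      (fun A => limit.lift (𝓡.matchingCod r ⋙ ⊤_ (R ⥤ E))
        { pt := A
          π :=
            { app := fun u => (hT u.obj.right).from A
              naturality := fun u u' f => (hT u'.obj.right).hom_ext _ _ } })
      fun A g => limit.hom_ext fun u => (hT u.obj.right).hom_ext _ _
  exact hM.hom_ext ((hT r).uniqueUpToIso hM).hom (𝓡.matchingMap (⊤_ (R ⥤ E)) r) ▸
    ((hT r).uniqueUpToIso hM).isIso_hom

end Matching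

/-! ### Latching and matching maps of Kan extensions from bounded degree -/

section KanExtension

open Functor

variable {n : WithBot ℕ} {F : (𝓡.degLE n).FullSubcategory ⥤ E} {Y : R ⥤ E}

lemma deg_lt_of_degLE {r t : R} (ht : 𝓡.degLE n t) (hr : ¬ 𝓡.degLE n r) : 𝓡.deg t < 𝓡.deg r := by
  have := ht.trans_lt (not_le.1 hr)
  exact_mod_cast this

section Left

variable {α : F ⟶ 𝓡.trunc n ⋙ Y}

/-- The composites `α.app t ≫ Y.map a` are the coprojections of the pointwise colimit formula for
`Y.obj r`, so they detect equality of maps out of it. -/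
lemma leftKanExtension_obj_hom_ext
    (hα : (LeftExtension.mk Y α).IsPointwiseLeftKanExtension) {r : R} {A : E} {f g : Y.obj r ⟶ A}
    (h : ∀ (t : (𝓡.degLE n).FullSubcategory) (a : t.obj ⟶ r),
      α.app t ≫ Y.map a ≫ f = α.app t ≫ Y.map a ≫ g) : f = g :=
  (hα r).hom_ext fun j =>
    (Category.assoc _ _ _).trans ((h j.left j.hom).trans (Category.assoc _ _ _).symm)

lemma exists_leftKanExtension_obj_desc
    (hα : (LeftExtension.mk Y α).IsPointwiseLeftKanExtension) {r : R} {A : E}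
    (φ : ∀ (t : (𝓡.degLE n).FullSubcategory) (_ : t.obj ⟶ r), F.obj t ⟶ A)
    (hφ : ∀ (t t' : (𝓡.degLE n).FullSubcategory) (w : t ⟶ t') (a : t'.obj ⟶ r),
      F.map w ≫ φ t' a = φ t (w.hom ≫ a)) :
    ∃ f : Y.obj r ⟶ A, ∀ (t : (𝓡.degLE n).FullSubcategory) (a : t.obj ⟶ r),
      α.app t ≫ Y.map a ≫ f = φ t a := by
  let c : Cocone (CostructuredArrow.proj (𝓡.trunc n) r ⋙ F) :=
    { pt := A
      ι :=
        { app := fun j => φ j.left j.hom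
          naturality := fun j j' f => by
            have h₁ := hφ j.left j'.left f.left j'.hom
            have h₂ : f.left.hom ≫ j'.hom = j.hom := CostructuredArrow.w f
            rw [h₂] at h₁
            exact h₁.trans (Category.comp_id _).symm } }
  exact ⟨(hα r).desc c, fun t a =>
    (Category.assoc _ _ _).symm.trans ((hα r).fac c (CostructuredArrow.mk (Y := t) a))⟩

/-- Above degree `n`, the latching maps of a pointwise left Kan extension along `t_n` are
invertible. -/
lemma isIso_latchingMap_of_isPointwiseLeftKanExtension
    (hα : (LeftExtension.mk Y α).IsPointwiseLeftKanExtension) (r : R)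
    [HasColimitsOfShape (𝓡.LatchingCategory r) E] (hr : ¬ 𝓡.degLE n r) :
    IsIso (𝓡.latchingMap Y r) := by
  -- The factorizations are chosen arbitrarily. The compatibility needed for `ψ` comes from
  -- `map_latchingι_eq`, which removes the dependence on the choice.
  choose u a hua using fun (t : (𝓡.degLE n).FullSubcategory) (f : t.obj ⟶ r) =>
    𝓡.exists_latching_factorization f (𝓡.deg_lt_of_degLE t.property hr)
  obtain ⟨ψ, hψ⟩ := 𝓡.exists_leftKanExtension_obj_desc hα
    (fun t f => α.app t ≫ Y.map (a t f) ≫ 𝓡.latchingι Y (u t f)) (by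
    intro t t' w f
    have h₁ : F.map w ≫ α.app t' = α.app t ≫ Y.map w.hom := α.naturality w
    have h₂ := 𝓡.map_latchingι_eq Y _ _ (w.hom ≫ a t' f) (a t (w.hom ≫ f)) (by
      rw [Category.assoc, hua, hua])
    rw [reassoc_of% h₁, ← h₂, Functor.map_comp_assoc])
  have : IsIso (𝓡.latchingMap Y r).hom := by
    change IsIso (𝓡.latchingMapHom Y r)
    -- The domain of `v` may itself have degree above `n`. Equality on its summand of the latching
    -- object is therefore tested on the generators `b : t ⟶ v.obj.left` with `deg t ≤ n`, using
    -- that `Y` is a pointwise Kan extension there too.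
    refine ⟨ψ, 𝓡.latchingObj_hom_ext _ fun v => 𝓡.leftKanExtension_obj_hom_ext hα fun t b => ?_,
      𝓡.leftKanExtension_obj_hom_ext hα fun t f => ?_⟩
    · have h₁ := 𝓡.latchingι_mapHom Y v
      have h₂ := 𝓡.map_latchingι_eq Y _ _ (a t (b ≫ v.obj.hom)) b (hua _ _)
      have h₃ : 𝓡.latchingι Y v ≫ 𝓡.latchingMapHom Y r ≫ ψ = Y.map v.obj.hom ≫ ψ := by
        rw [← Category.assoc]
        exact congrArg (· ≫ ψ) h₁
      calc
        _ = α.app t ≫ Y.map b ≫ Y.map v.obj.hom ≫ ψ := congrArg (α.app t ≫ Y.map b ≫ ·) h₃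
        _ = α.app t ≫ Y.map (b ≫ v.obj.hom) ≫ ψ := by rw [Functor.map_comp_assoc]
        _ = α.app t ≫ Y.map b ≫ 𝓡.latchingι Y v := (hψ _ _).trans (congrArg (α.app t ≫ ·) h₂)
        _ = _ := congrArg (α.app t ≫ Y.map b ≫ ·) (Category.comp_id _).symm
    · rw [reassoc_of% (hψ t f), latchingι_mapHom, ← Functor.map_comp, hua, Category.comp_id]
  exact Action.isIso_of_hom_isIso _

end Left

section Right

variable {α : 𝓡.trunc n ⋙ Y ⟶ F}

lemma rightKanExtension_obj_hom_ext
    (hα : (RightExtension.mk Y α).IsPointwiseRightKanExtension) {r : R} {A : E} {f g : A ⟶ Y.obj r}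
    (h : ∀ (t : (𝓡.degLE n).FullSubcategory) (a : r ⟶ t.obj),
      f ≫ Y.map a ≫ α.app t = g ≫ Y.map a ≫ α.app t) : f = g :=
  (hα r).hom_ext fun j => h j.right j.hom

lemma exists_rightKanExtension_obj_lift
    (hα : (RightExtension.mk Y α).IsPointwiseRightKanExtension) {r : R} {A : E}
    (φ : ∀ (t : (𝓡.degLE n).FullSubcategory) (_ : r ⟶ t.obj), A ⟶ F.obj t)
    (hφ : ∀ (t t' : (𝓡.degLE n).FullSubcategory) (w : t ⟶ t') (a : r ⟶ t.obj),
      φ t a ≫ F.map w = φ t' (a ≫ w.hom)) :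
    ∃ f : A ⟶ Y.obj r, ∀ (t : (𝓡.degLE n).FullSubcategory) (a : r ⟶ t.obj),
      f ≫ Y.map a ≫ α.app t = φ t a := by
  let c : Cone (StructuredArrow.proj r (𝓡.trunc n) ⋙ F) :=
    { pt := A
      π :=
        { app := fun j => φ j.right j.hom
          naturality := fun j j' f => by
            have h₁ := hφ j.right j'.right f.right j.hom
            have h₂ : j.hom ≫ f.right.hom = j'.hom := StructuredArrow.w f
            rw [h₂] at h₁
            exact (Category.id_comp _).trans h₁.symm } }
  exact ⟨(hα r).lift c, fun t a => (hα r).fac c (StructuredArrow.mk (Y := t) a)⟩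

/-- Above degree `n`, the matching maps of a pointwise right Kan extension along `t_n` are
invertible. -/
lemma isIso_matchingMap_of_isPointwiseRightKanExtension
    (hα : (RightExtension.mk Y α).IsPointwiseRightKanExtension) (r : R)
    [HasLimitsOfShape (𝓡.MatchingCategory r) E] (hr : ¬ 𝓡.degLE n r) :
    IsIso (𝓡.matchingMap Y r) := by
  choose u a hua using fun (t : (𝓡.degLE n).FullSubcategory) (f : r ⟶ t.obj) =>
    𝓡.exists_matching_factorization f (𝓡.deg_lt_of_degLE t.property hr)
  obtain ⟨ψ, hψ⟩ := 𝓡.exists_rightKanExtension_obj_lift hα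
    -- The inverse projects to the middle object of a chosen factorization of `f`;
    -- `matchingπ_map_eq` makes this a cone.
    (fun t f => (𝓡.matchingπ Y (u t f) ≫ Y.map (a t f)) ≫ α.app t) (by
    intro t t' w f
    have h₁ : α.app t ≫ F.map w = Y.map w.hom ≫ α.app t' := (α.naturality w).symm
    have h₂ := 𝓡.matchingπ_map_eq Y _ _ (a t f ≫ w.hom) (a t' (f ≫ w.hom)) (by
      rw [← Category.assoc, hua, hua])
    rw [Category.assoc, h₁, ← h₂, Functor.map_comp, Category.assoc, Category.assoc,
      Category.assoc])
  refine ⟨ψ, 𝓡.rightKanExtension_obj_hom_ext hα fun t f => ?_,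
    𝓡.matchingObj_hom_ext _ fun v => 𝓡.rightKanExtension_obj_hom_ext hα fun t b => ?_⟩
  · have h₁ := 𝓡.matchingMap_matchingπ Y (u t f)
    rw [Category.assoc, hψ, Category.assoc, reassoc_of% h₁, ← Functor.map_comp_assoc, hua,
      Category.id_comp]
  · have h₁ := 𝓡.matchingMap_matchingπ Y v
    have h₂ := 𝓡.matchingπ_map_eq Y _ _ (a t (v.obj.hom ≫ b)) b (hua _ _)
    rw [Category.assoc, Category.assoc, reassoc_of% h₁, ← Functor.map_comp_assoc, hψ, h₂,
      Category.id_comp, Category.assoc]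

end Right

/-- Above degree `n`, the latching maps of `sk_n X` are invertible. -/
lemma isIso_latchingMap_sk
    [∀ (n : WithBot ℕ) (r : R), HasColimitsOfShape (CostructuredArrow (𝓡.trunc n) r) E]
    (n : WithBot ℕ) (X : R ⥤ E) (r : R) [HasColimitsOfShape (𝓡.LatchingCategory r) E]
    (hr : ¬ 𝓡.degLE n r) : IsIso (𝓡.latchingMap ((𝓡.sk n).obj X) r) :=
  𝓡.isIso_latchingMap_of_isPointwiseLeftKanExtension
    ((𝓡.trunc n).isPointwiseLeftKanExtensionLeftKanExtensionUnit (𝓡.trunc n ⋙ X)) r hr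

/-- Above degree `n`, the matching maps of `cosk_n X` are invertible. -/
lemma isIso_matchingMap_cosk
    [∀ (n : WithBot ℕ) (r : R), HasLimitsOfShape (StructuredArrow r (𝓡.trunc n)) E]
    (n : WithBot ℕ) (X : R ⥤ E) (r : R) [HasLimitsOfShape (𝓡.MatchingCategory r) E]
    (hr : ¬ 𝓡.degLE n r) : IsIso (𝓡.matchingMap ((𝓡.cosk n).obj X) r) :=
  𝓡.isIso_matchingMap_of_isPointwiseRightKanExtension
    ((𝓡.trunc n).isPointwiseRightKanExtensionRanCounit (𝓡.trunc n ⋙ X)) r hr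

end KanExtension

section Reedy

variable [ModelCategory E]

/-! ### Reedy cofibrations between skeleta -/

section Cofibrations

instance (G : Type*) [Monoid G] : (projectiveCofibrations E G).IsMultiplicative := by
  unfold projectiveCofibrations
  infer_instance

instance (G : Type*) [Monoid G] : (projectiveCofibrations E G).RespectsIso := by
  unfold projectiveCofibrations
  infer_instance

variable [∀ r, HasColimitsOfShape (𝓡.LatchingCategory r) E]

/-- The map of latching objects is invertible, hence so is its cobase change `X_r ⟶ X_r ∪ L_r(Y)`.
Composed with the relative latching map it gives the invertible `f.app r`. -/
lemma relativeLatchingMap_mem_of_isIso {X Y : R ⥤ E} (f : X ⟶ Y) (r : R)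
    (hf : ∀ s, 𝓡.deg s ≤ 𝓡.deg r → IsIso (f.app s)) :
    projectiveCofibrations E (Aut r) (𝓡.relativeLatchingMap f r) := by
  have h₁ := 𝓡.isIso_latchingFunctoriality f r hf
  have h₂ := hf r le_rfl
  have h₃ := isIso_objActionMap f r
  have h₄ : pushout.inl _ _ ≫ 𝓡.relativeLatchingMap f r = objActionMap f r :=
    pushout.inl_desc _ _ _
  have : IsIso (𝓡.relativeLatchingMap f r) := IsIso.of_isIso_fac_left h₄
  exact MorphismProperty.of_isIso _ _

/-- The coprojection of `L_r(Y)` into the pushout is a cobase change of the latching map of `X`,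
hence invertible, and it identifies the relative latching map with that of `Y`. -/
lemma relativeLatchingMap_mem_iff {X Y : R ⥤ E} (f : X ⟶ Y) (r : R)
    [IsIso (𝓡.latchingMap X r)] :
    projectiveCofibrations E (Aut r) (𝓡.relativeLatchingMap f r) ↔
      projectiveCofibrations E (Aut r) (𝓡.latchingMap Y r) := by
  have h : pushout.inr _ _ ≫ 𝓡.relativeLatchingMap f r = 𝓡.latchingMap Y r :=
    pushout.inr_desc _ _ _
  rw [← h, MorphismProperty.cancel_left_of_respectsIso (projectiveCofibrations E (Aut r))]

/-- A functor is Reedy cofibrant if and only if its latching maps are projective cofibrations. -/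
lemma isReedyCofibrant_iff (X : R ⥤ E) :
    𝓡.IsReedyCofibrant X ↔ ∀ r, projectiveCofibrations E (Aut r) (𝓡.latchingMap X r) :=
  forall_congr' fun r => by
    have := 𝓡.isIso_latchingMap_initial (E := E) r
    exact 𝓡.relativeLatchingMap_mem_iff _ r

lemma latchingMap_mem_of_isIso {X Y : R ⥤ E} (g : X ⟶ Y) (r : R)
    (hg : ∀ s, 𝓡.deg s ≤ 𝓡.deg r → IsIso (g.app s))
    (hY : projectiveCofibrations E (Aut r) (𝓡.latchingMap Y r)) :
    projectiveCofibrations E (Aut r) (𝓡.latchingMap X r) := by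
  have h₁ := 𝓡.isIso_latchingFunctoriality g r hg
  have h₂ := hg r le_rfl
  have h₃ := isIso_objActionMap g r
  rw [← MorphismProperty.cancel_right_of_respectsIso (projectiveCofibrations E (Aut r)) _
    (objActionMap g r), latching_square,
    MorphismProperty.cancel_left_of_respectsIso (projectiveCofibrations E (Aut r))]
  exact hY

variable [∀ (n : WithBot ℕ) (r : R), HasColimitsOfShape (CostructuredArrow (𝓡.trunc n) r) E]

/-- If `sk_m X ⟶ Y ⟶ X` factors the counit, and if in every degree either `Y ⟶ X` is invertible up
to this degree or the latching maps of `Y` are invertible, then `Y` is Reedy cofibrant and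
`sk_m X ⟶ Y` is a Reedy cofibration as soon as `X` is Reedy cofibrant. -/
lemma isReedyCofibration_of_skCounit_fac {X Y : R ⥤ E} (hX : 𝓡.IsReedyCofibrant X)
    {m : WithBot ℕ} (f : (𝓡.sk m).obj X ⟶ Y) (g : Y ⟶ X) (hfg : f ≫ g = 𝓡.skCounit m X)
    (hg : ∀ s, 𝓡.degLE m s → IsIso (g.app s))
    (hY : ∀ r, (∀ s, 𝓡.deg s ≤ 𝓡.deg r → IsIso (g.app s)) ∨ IsIso (𝓡.latchingMap Y r)) :
    𝓡.IsReedyCofibrant Y ∧ 𝓡.IsReedyCofibration f := by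
  rw [isReedyCofibrant_iff] at hX ⊢
  have hY' (r : R) : projectiveCofibrations E (Aut r) (𝓡.latchingMap Y r) := by
    obtain h | h := hY r
    · exact 𝓡.latchingMap_mem_of_isIso g r h (hX r)
    · exact MorphismProperty.of_isIso _ _
  refine ⟨hY', fun r => ?_⟩
  -- Up to degree `m`, both `g` and the counit are invertible, hence so is `f`. Above degree `m`,
  -- the latching map of `sk_m X` is invertible and only that of `Y` matters.
  by_cases hr : 𝓡.degLE m r
  · refine 𝓡.relativeLatchingMap_mem_of_isIso f r fun s hs => ?_
    have hs' : 𝓡.degLE m s := le_trans (by exact_mod_cast hs) hr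
    have h₁ := hg s hs'
    have h₂ := 𝓡.isIso_skCounit_app X hs'
    exact IsIso.of_isIso_fac_right (congr_app hfg s)
  · have := 𝓡.isIso_latchingMap_sk m X r hr
    exact (𝓡.relativeLatchingMap_mem_iff f r).2 (hY' r)

lemma isReedyCofibration_skMap {X : R ⥤ E} (hX : 𝓡.IsReedyCofibrant X) {m n : WithBot ℕ}
    (h : m ≤ n) : 𝓡.IsReedyCofibrant ((𝓡.sk n).obj X) ∧ 𝓡.IsReedyCofibration (𝓡.skMap h X) := by
  refine 𝓡.isReedyCofibration_of_skCounit_fac hX _ (𝓡.skCounit n X) (𝓡.skMap_skCounit h X)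
    (fun s hs => 𝓡.isIso_skCounit_app X (hs.trans h)) fun r => ?_
  by_cases hr : 𝓡.degLE n r
  · exact Or.inl fun s hs => 𝓡.isIso_skCounit_app X (le_trans (by exact_mod_cast hs) hr)
  · exact Or.inr (𝓡.isIso_latchingMap_sk n X r hr)

/-- The case `n = ∞`, where `Y` is any model of the colimit of the skeleta. -/
lemma isReedyCofibration_of_isIso {X Y : R ⥤ E} (hX : 𝓡.IsReedyCofibrant X)
    {m : WithBot ℕ} (f : (𝓡.sk m).obj X ⟶ Y) (g : Y ⟶ X) (hg : IsIso g)
    (hfg : f ≫ g = 𝓡.skCounit m X) : 𝓡.IsReedyCofibrant Y ∧ 𝓡.IsReedyCofibration f :=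
  𝓡.isReedyCofibration_of_skCounit_fac hX f g hfg (fun _ _ => inferInstance)
    fun _ => Or.inl fun _ _ => inferInstance

end Cofibrations

/-! ### Reedy fibrations between coskeleta -/

section Fibrations

variable [∀ r, HasLimitsOfShape (𝓡.MatchingCategory r) E]

lemma relativeMatchingMap_mem_of_isIso {X Y : R ⥤ E} (f : X ⟶ Y) (r : R)
    (hf : ∀ s, 𝓡.deg s ≤ 𝓡.deg r → IsIso (f.app s)) :
    fibrations E (𝓡.relativeMatchingMap f r) := by
  have h₁ := 𝓡.isIso_matchingFunctoriality f r hf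
  have h₂ := hf r le_rfl
  have h₃ : 𝓡.relativeMatchingMap f r ≫ pullback.snd _ _ = f.app r :=
    pullback.lift_snd _ _ _
  have : IsIso (𝓡.relativeMatchingMap f r) := IsIso.of_isIso_fac_right h₃
  exact MorphismProperty.of_isIso _ _

lemma relativeMatchingMap_mem_iff {X Y : R ⥤ E} (f : X ⟶ Y) (r : R)
    [IsIso (𝓡.matchingMap Y r)] :
    fibrations E (𝓡.relativeMatchingMap f r) ↔ fibrations E (𝓡.matchingMap X r) := by
  have h : 𝓡.relativeMatchingMap f r ≫ pullback.fst _ _ = 𝓡.matchingMap X r :=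
    pullback.lift_fst _ _ _
  rw [← h, MorphismProperty.cancel_right_of_respectsIso (fibrations E)]

/-- A functor is Reedy fibrant if and only if its matching maps are fibrations. -/
lemma isReedyFibrant_iff (X : R ⥤ E) :
    𝓡.IsReedyFibrant X ↔ ∀ r, fibrations E (𝓡.matchingMap X r) :=
  forall_congr' fun r => by
    have := 𝓡.isIso_matchingMap_terminal (E := E) r
    exact 𝓡.relativeMatchingMap_mem_iff _ r

/-- Fibrancy is transferred along the direction of `g`, because the unit goes from `X` to its
coskeleton. -/
lemma matchingMap_mem_of_isIso {X Y : R ⥤ E} (g : X ⟶ Y) (r : R)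
    (hg : ∀ s, 𝓡.deg s ≤ 𝓡.deg r → IsIso (g.app s))
    (hX : fibrations E (𝓡.matchingMap X r)) : fibrations E (𝓡.matchingMap Y r) := by
  have h₁ := 𝓡.isIso_matchingFunctoriality g r hg
  have h₂ := hg r le_rfl
  rw [← MorphismProperty.cancel_left_of_respectsIso (fibrations E) (g.app r), ← matching_square,
    MorphismProperty.cancel_right_of_respectsIso (fibrations E)]
  exact hX

variable [∀ (n : WithBot ℕ) (r : R), HasLimitsOfShape (StructuredArrow r (𝓡.trunc n)) E]

/-- If `X ⟶ Y ⟶ cosk_m X` factors the unit, and if in every degree either `X ⟶ Y` is invertible up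
to this degree or the matching maps of `Y` are invertible, then `Y` is Reedy fibrant and
`Y ⟶ cosk_m X` is a Reedy fibration as soon as `X` is Reedy fibrant. -/
lemma isReedyFibration_of_coskUnit_fac {X Y : R ⥤ E} (hX : 𝓡.IsReedyFibrant X)
    {m : WithBot ℕ} (f : Y ⟶ (𝓡.cosk m).obj X) (g : X ⟶ Y) (hgf : g ≫ f = 𝓡.coskUnit m X)
    (hg : ∀ s, 𝓡.degLE m s → IsIso (g.app s))
    (hY : ∀ r, (∀ s, 𝓡.deg s ≤ 𝓡.deg r → IsIso (g.app s)) ∨ IsIso (𝓡.matchingMap Y r)) :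
    𝓡.IsReedyFibrant Y ∧ 𝓡.IsReedyFibration f := by
  rw [isReedyFibrant_iff] at hX ⊢
  have hY' (r : R) : fibrations E (𝓡.matchingMap Y r) := by
    obtain h | h := hY r
    · exact 𝓡.matchingMap_mem_of_isIso g r h (hX r)
    · exact MorphismProperty.of_isIso _ _
  refine ⟨hY', fun r => ?_⟩
  by_cases hr : 𝓡.degLE m r
  · refine 𝓡.relativeMatchingMap_mem_of_isIso f r fun s hs => ?_
    have hs' : 𝓡.degLE m s := le_trans (by exact_mod_cast hs) hr
    have h₁ := hg s hs'
    have h₂ := 𝓡.isIso_coskUnit_app X hs'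
    exact IsIso.of_isIso_fac_left (congr_app hgf s)
  · have := 𝓡.isIso_matchingMap_cosk m X r hr
    exact (𝓡.relativeMatchingMap_mem_iff f r).2 (hY' r)

lemma isReedyFibration_coskMap {X : R ⥤ E} (hX : 𝓡.IsReedyFibrant X) {m n : WithBot ℕ}
    (h : m ≤ n) : 𝓡.IsReedyFibrant ((𝓡.cosk n).obj X) ∧ 𝓡.IsReedyFibration (𝓡.coskMap h X) := by
  refine 𝓡.isReedyFibration_of_coskUnit_fac hX _ (𝓡.coskUnit n X) (𝓡.coskUnit_coskMap h X)
    (fun s hs => 𝓡.isIso_coskUnit_app X (hs.trans h)) fun r => ?_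
  by_cases hr : 𝓡.degLE n r
  · exact Or.inl fun s hs => 𝓡.isIso_coskUnit_app X (le_trans (by exact_mod_cast hs) hr)
  · exact Or.inr (𝓡.isIso_matchingMap_cosk n X r hr)

lemma isReedyFibration_of_isIso {X Y : R ⥤ E} (hX : 𝓡.IsReedyFibrant X)
    {m : WithBot ℕ} (f : Y ⟶ (𝓡.cosk m).obj X) (g : X ⟶ Y) (hg : IsIso g)
    (hgf : g ≫ f = 𝓡.coskUnit m X) : 𝓡.IsReedyFibrant Y ∧ 𝓡.IsReedyFibration f :=
  𝓡.isReedyFibration_of_coskUnit_fac hX f g hgf (fun _ _ => inferInstance)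
    fun _ => Or.inl fun _ _ => inferInstance

end Fibrations

end Reedy

end GeneralizedReedyStructure

/-! ### Assembly of the finite and infinite cases -/

theorem proposition6 {R : Type u₁} [Category.{v₁} R] (𝓡 : GeneralizedReedyStructure R)
    {E : Type u₂} [Category.{v₂} E] [ModelCategory E]
    [∀ r : R, HasColimitsOfShape (𝓡.LatchingCategory r) E]
    [∀ r : R, HasLimitsOfShape (𝓡.MatchingCategory r) E]
    [∀ (n : WithBot ℕ) (r : R), HasColimitsOfShape (CostructuredArrow (𝓡.trunc n) r) E]
    [∀ (n : WithBot ℕ) (r : R), HasLimitsOfShape (StructuredArrow r (𝓡.trunc n)) E]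
    (X : R ⥤ E) :
    -- (i) for Reedy cofibrant `X`: first `m < n < ∞`, then `n = ∞`, where `sk_∞ X` is any
    -- colimit of the skeletal system, in particular `X` itself with the counits
    (𝓡.IsReedyCofibrant X →
      (∀ (m n : WithBot ℕ) (h : m < n),
        𝓡.IsReedyCofibrant ((𝓡.sk m).obj X) ∧ 𝓡.IsReedyCofibrant ((𝓡.sk n).obj X) ∧
          𝓡.IsReedyCofibration (𝓡.skMap h.le X)) ∧
      (∀ (c : Cocone (𝓡.skSystem X)), IsColimit c → ∀ m : WithBot ℕ,
        𝓡.IsReedyCofibrant ((𝓡.sk m).obj X) ∧ 𝓡.IsReedyCofibrant c.pt ∧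
          𝓡.IsReedyCofibration (X := (𝓡.sk m).obj X) (c.ι.app m)) ∧
      (∀ m : WithBot ℕ, 𝓡.IsReedyCofibration (𝓡.skCounit m X))) ∧
    -- (ii) for Reedy fibrant `X`: dually
    (𝓡.IsReedyFibrant X →
      (∀ (m n : WithBot ℕ) (h : m < n),
        𝓡.IsReedyFibrant ((𝓡.cosk n).obj X) ∧ 𝓡.IsReedyFibrant ((𝓡.cosk m).obj X) ∧
          𝓡.IsReedyFibration (𝓡.coskMap h.le X)) ∧
      (∀ (c : Cone (𝓡.coskSystem X)), IsLimit c → ∀ m : WithBot ℕ,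
        𝓡.IsReedyFibrant c.pt ∧ 𝓡.IsReedyFibrant ((𝓡.cosk m).obj X) ∧
          𝓡.IsReedyFibration (Y := (𝓡.cosk m).obj X) (c.π.app (Opposite.op m))) ∧
      (∀ m : WithBot ℕ, 𝓡.IsReedyFibration (𝓡.coskUnit m X))) := by
  -- Cofibrancy of the lower skeleton `sk_m X` is the case `m = n` of `isReedyCofibration_skMap`.
  refine ⟨fun hX => ⟨fun m n h => ⟨(𝓡.isReedyCofibration_skMap hX le_rfl).1,
    𝓡.isReedyCofibration_skMap hX h.le⟩, fun c hc m =>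
      ⟨(𝓡.isReedyCofibration_skMap hX le_rfl).1, ?_⟩, fun m => ?_⟩,
    fun hX => ⟨fun m n h => ?_, fun c hc m => ?_, fun m => ?_⟩⟩
  · obtain ⟨hc'⟩ := 𝓡.nonempty_isColimit_skCocone X
    -- The comparison isomorphism from `c.pt` to `X` turns the coprojection at `m` into the counit,
    -- as the factorization lemma requires.
    have h := hc.comp_coconePointUniqueUpToIso_hom hc' m
    have := (hc.coconePointUniqueUpToIso hc').isIso_hom
    exact 𝓡.isReedyCofibration_of_isIso hX (c.ι.app m) (hc.coconePointUniqueUpToIso hc').hom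
      this h
  · exact (𝓡.isReedyCofibration_of_isIso hX (𝓡.skCounit m X) (𝟙 X) inferInstance
      (Category.comp_id _)).2
  · obtain ⟨h₁, h₂⟩ := 𝓡.isReedyFibration_coskMap hX h.le
    exact ⟨h₁, (𝓡.isReedyFibration_coskMap hX le_rfl).1, h₂⟩
  · obtain ⟨hc'⟩ := 𝓡.nonempty_isLimit_coskCone X
    have h := hc'.conePointUniqueUpToIso_hom_comp hc (Opposite.op m)
    have := (hc'.conePointUniqueUpToIso hc).isIso_hom
    obtain ⟨h₁, h₂⟩ := 𝓡.isReedyFibration_of_isIso hX (c.π.app (Opposite.op m))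
      (hc'.conePointUniqueUpToIso hc).hom this h
    exact ⟨h₁, (𝓡.isReedyFibration_coskMap hX le_rfl).1, h₂⟩
  · exact (𝓡.isReedyFibration_of_isIso hX (𝓡.coskUnit m X) (𝟙 X) inferInstance
      (Category.id_comp _)).2
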